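/- Let $\Theta\subseteq\mathbb{R}^d$ be a nonempty compact set, let $\{P_\theta:\theta\in\Theta\}$ be probability distributions on a measurable space $\mathcal{X}$, let $\mathbb{X}^n=(X_1,\dots,X_n)$ be $n$ independent samples from $P_\theta$, and let $M:\Theta\times\Theta\to\mathbb{R}$ be a measurable loss function. Let $\mathcal{D}$ be the set of deterministic estimators, i.e. of all measurable functions $\hat\theta:\mathcal{X}^n\to\Theta$; let $\mathcal{M}_{\mathcal{D}}$ be the set of randomized estimators, i.e. of probability distributions on $\mathcal{D}$ (a deterministic estimator $\hat\theta_\omega$ is sampled at random, independently of the data, with $\hat\theta_\omega(x)$ jointly measurable in $(\omega,x)$, and is then applied to the data) whose expected loss is finite at every $\theta$; and let $\mathcal{M}_\Theta$ be the set of Borel probability measures on $\Theta$. The risk is $R(\hat\theta,\theta)=\mathbb{E}[M(\hat\theta(\mathbb{X}^n),\theta)]$, the expectation being over $\mathbb{X}^n\sim P_\theta^n$ and the randomness of the estimator, and $R(\hat\theta,P)=\mathbb{E}_{\theta\sim P}[R(\hat\theta,\theta)]$. Assume that the risk of every deterministic estimator is well defined and finite (i.e. its loss is integrable at every $\theta$)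 and that, for some constant $L$, \[ |R(\hat\theta,\theta_1)-R(\hat\theta,\theta_2)|\le L\|\theta_1-\theta_2\|_1\qquad\text{for all }\hat\theta\in\mathcal{D},\ \theta_1,\theta_2\in\Theta . \] Then, as elements of $[-\infty,\infty]$, \[ \inf_{\hat\theta\in\mathcal{M}_{\mathcal{D}}}\ \sup_{P\in\mathcal{M}_\Theta}R(\hat\theta,P)=\sup_{P\in\mathcal{M}_\Theta}\ \inf_{\hat\theta\in\mathcal{M}_{\mathcal{D}}}R(\hat\theta,P)=:R^* . \] Suppose furthermore that the risk $R(\hat\theta,\theta)$ is bounded over $\hat\theta\in\mathcal{D}$, $\theta\in\Theta$ and that $\Theta$ is compact with respect to the (pseudo)metric $\Delta_M(\theta_1,\theta_2)=\sup_{\theta\in\Theta}|M(\theta_1,\theta)-M(\theta_2,\theta)|$. Then there exists a minimax estimator $\hat\theta^*\in\mathcal{M}_{\mathcal{D}}$ (i.e. $\sup_{\theta}R(\hat\theta^*,\theta)=\inf_{\hat\theta\in\mathcal{M}_{\mathcal{D}}}\sup_{\theta}R(\hat\theta,\theta)$) with \[ \sup_{\theta\in\Theta}R(\hat\theta^*,\theta)=R^*,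 \] and there exists a least favorable prior $P^*\in\mathcal{M}_\Theta$ (i.e. $\inf_{\hat\theta\in\mathcal{M}_{\mathcal{D}}}R(\hat\theta,P^*)=\sup_{P\in\mathcal{M}_\Theta}\inf_{\hat\theta\in\mathcal{M}_{\mathcal{D}}}R(\hat\theta,P)$) with \[ \inf_{\hat\theta\in\mathcal{D}}R(\hat\theta,P^*)=R^* . \] -/

import Mathlib

open MeasureTheory
open scoped ENNReal

noncomputable section

namespace StatGame

variable {𝒳 T : Type*} [MeasurableSpace 𝒳] [MeasurableSpace T]

/-- The law of `n` independent samples `X₁, …, Xₙ` drawn from `P θ`. -/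
def sampleLaw (P : T → ProbabilityMeasure 𝒳) (n : ℕ) (θ : T) : Measure (Fin n → 𝒳) :=
  Measure.pi fun _ : Fin n => (P θ : Measure 𝒳)

/-- The set `𝒟` of deterministic estimators: all measurable functions `𝒳ⁿ → T`. -/
abbrev DetEstimator (𝒳 T : Type*) [MeasurableSpace 𝒳] [MeasurableSpace T] (n : ℕ) : Type _ :=
  {f : (Fin n → 𝒳) → T // Measurable f}

/-- The set `ℳ_𝒟` of randomized estimators. A probability distribution on `𝒟` is given as the
distribution of a `𝒟`-valued random element `ω ↦ est ω` on a probability space `(Ω, law)`: the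
parameter is estimated by sampling `ω`, and then applying the deterministic estimator `est ω` to
the data. The estimate has to be a random variable, that is, jointly measurable in `ω` and the
data. (For uncountable `𝒳` there is no σ-algebra on `𝒟` that makes `(f, x) ↦ f x` measurable, so
the σ-algebra is put on the sampling space.) Moreover the expected loss has to be well defined
and finite, so that the estimator has a risk at each `θ`. -/
structure RandEstimator (P : T → ProbabilityMeasure 𝒳) (n : ℕ) (M : T → T → ℝ) where
  Ω : Type
  mΩ : MeasurableSpace Ω
  law : Measure Ω
  isProb : IsProbabilityMeasure law
  est : Ω → DetEstimator 𝒳 T n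
  measurable_est : Measurable fun p : Ω × (Fin n → 𝒳) => (est p.1).1 p.2
  integrable_loss : ∀ θ : T,
    Integrable (fun p : Ω × (Fin n → 𝒳) => M ((est p.1).1 p.2) θ) (law.prod (sampleLaw P n θ))

attribute [instance] RandEstimator.mΩ RandEstimator.isProb

variable (P : T → ProbabilityMeasure 𝒳) {n : ℕ} (M : T → T → ℝ)

/-- The risk `R(f, θ) = 𝔼[M(f(X₁, …, Xₙ), θ)]` of a deterministic estimator `f`. -/
def detRisk (f : DetEstimator 𝒳 T n) (θ : T) : ℝ :=
  ∫ x, M (f.1 x) θ ∂(sampleLaw P n θ)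

/-- The integrated risk `R(f, Q) = 𝔼_{θ ∼ Q} R(f, θ)` of a deterministic estimator `f`. -/
def detIntRisk (f : DetEstimator 𝒳 T n) (Q : ProbabilityMeasure T) : ℝ :=
  ∫ θ, detRisk P M f θ ∂(Q : Measure T)

variable {P M}

/-- The risk `R(δ, θ)` of a randomized estimator `δ`: the expected loss with respect to the
randomness of the data and of the estimator. -/
def risk (δ : RandEstimator P n M) (θ : T) : ℝ :=
  ∫ p, M ((δ.est p.1).1 p.2) θ ∂(δ.law.prod (sampleLaw P n θ))

/-- The integrated risk `R(δ, Q) = 𝔼_{θ ∼ Q} R(δ, θ)` of a randomized estimator `δ`. -/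
def intRisk (δ : RandEstimator P n M) (Q : ProbabilityMeasure T) : ℝ :=
  ∫ θ, risk δ θ ∂(Q : Measure T)

/-- The worst-case risk `sup_θ R(δ, θ)`. -/
def worstRisk (δ : RandEstimator P n M) : EReal :=
  ⨆ θ : T, (risk δ θ : EReal)

variable (P n M)

/-- The minmax value `inf_{δ ∈ ℳ_𝒟} sup_{Q ∈ ℳ_Θ} R(δ, Q)` of the linearized game. -/
def minmaxValue : EReal :=
  ⨅ δ : RandEstimator P n M, ⨆ Q : ProbabilityMeasure T, (intRisk δ Q : EReal)

/-- The maxmin value `sup_{Q ∈ ℳ_Θ} inf_{δ ∈ ℳ_𝒟} R(δ, Q)` of the linearized game. -/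
def maxminValue : EReal :=
  ⨆ Q : ProbabilityMeasure T, ⨅ δ : RandEstimator P n M, (intRisk δ Q : EReal)

variable {P n M}

/-- `δ` is a minimax estimator: its worst-case risk is the minimax risk
`inf_{δ' ∈ ℳ_𝒟} sup_θ R(δ', θ)`. -/
def IsMinimax (δ : RandEstimator P n M) : Prop :=
  worstRisk δ = ⨅ δ' : RandEstimator P n M, worstRisk δ'

variable (P n M)

/-- `Q` is a least favorable prior: it maximizes the Bayes risk `inf_{δ ∈ ℳ_𝒟} R(δ, Q)`. -/
def IsLeastFavorable (Q : ProbabilityMeasure T) : Prop :=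
  ⨅ δ : RandEstimator P n M, (intRisk δ Q : EReal) = maxminValue P n M

/-- The parameter set, viewed as a space with the distance `Δ_M`. -/
def LossSpace {T : Type*} (_M : T → T → ℝ) : Type _ := T

/-- The distance `Δ_M(θ₁, θ₂) = sup_θ |M(θ₁, θ) - M(θ₂, θ)|`. -/
def lossDist {T : Type*} (M : T → T → ℝ) (θ₁ θ₂ : T) : ℝ≥0∞ :=
  ⨆ θ : T, ENNReal.ofReal |M θ₁ θ - M θ₂ θ|

instance {T : Type*} (M : T → T → ℝ) : PseudoEMetricSpace (LossSpace M) where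
  edist := lossDist M
  edist_self a := by simp [lossDist]
  edist_comm a b := by simp only [lossDist, abs_sub_comm]
  edist_triangle a b c := by
    refine iSup_le fun θ => ?_
    calc ENNReal.ofReal |M a θ - M c θ|
        ≤ ENNReal.ofReal (|M a θ - M b θ| + |M b θ - M c θ|) :=
          ENNReal.ofReal_le_ofReal (abs_sub_le _ _ _)
      _ ≤ ENNReal.ofReal |M a θ - M b θ| + ENNReal.ofReal |M b θ - M c θ| :=
          ENNReal.ofReal_add_le
      _ ≤ lossDist M a b + lossDist M b c :=
          add_le_add (le_iSup (fun θ => ENNReal.ofReal |M a θ - M b θ|) θ)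
            (le_iSup (fun θ => ENNReal.ofReal |M b θ - M c θ|) θ)

end StatGame

end

/-! Equality of the values is a separation argument. The Lipschitz bound survives averaging over
`ω`, so every risk function is continuous on the compact `Θ`, and mixing estimators makes the risk
functions a convex subset of `C(Θ, ℝ)`. If none lies strictly below `c` everywhere, Hahn–Banach
separates this set from the open convex set `{h < c}`. The separating functional is positive and
nonzero, and its normalized Riesz measure is a prior with Bayes risk at least `c`. Taking `c` equal
to a finite min-max value gives a least favorable prior. Fubini shows that randomization does not
lower its Bayes risk.

A minimax estimator needs compactness on the side of the estimators, although `𝒳` has no topology.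
On a dense sequence `θ k`, all sample laws have, up to positive factors, densities `τ k` in `[0, 1]`
for one probability measure `μ`. The risk at `θ k` then depends only on the joint law of the
densities and the loss sequence `(M a (θ k))_k`. These laws live on a compact metrizable space, so
nearly minimax estimators have a limit law. It is lifted from loss sequences to actions in `Θ`, then
realized by an estimator that uses the data through `τ` and an independent uniform variable.
Continuity of the risk passes from the dense sequence to `Θ`. -/

namespace StatGame

open Filter Topology Set
open scoped unitInterval ProbabilityTheory

/-! ### Lifting finite measures through surjections -/

/-- On a compact space, a probability measure carried by the range of a continuous map lifts
through this map. -/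
theorem exists_probabilityMeasure_map_eq_of_compactSpace {C F : Type*} [TopologicalSpace C]
    [CompactSpace C] [TopologicalSpace.MetrizableSpace C] [MeasurableSpace C] [BorelSpace C]
    [TopologicalSpace F] [TopologicalSpace.MetrizableSpace F] [MeasurableSpace F] [BorelSpace F]
    {f : C → F} (hf : Continuous f) (μ : ProbabilityMeasure F)
    (hμ : ∀ᵐ y ∂(μ : Measure F), y ∈ range f) :
    ∃ ν : ProbabilityMeasure C, ν.map hf.measurable.aemeasurable = μ := by
  let := TopologicalSpace.metrizableSpaceMetric F
  let := TopologicalSpace.metrizableSpaceMetric C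
  have hne : Nonempty C := by
    obtain ⟨y, x, -⟩ := hμ.exists
    exact ⟨x⟩
  let c := TopologicalSpace.denseSeq C
  -- A measurable approximate section: among finitely many points of a dense sequence, take one
  -- whose image is nearest to `y`. Only `f (s N y)` has to converge; the lifted measures converge
  -- along an ultrafilter by compactness.
  let s : ℕ → F → C := fun N y => c (SimpleFunc.nearestPtInd (f ∘ c) N y)
  have hs : ∀ N, Measurable (s N) := fun N =>
    (measurable_of_countable c).comp (SimpleFunc.nearestPtInd (f ∘ c) N).measurable
  have hlim : ∀ y ∈ range f, Tendsto (fun N => f (s N y)) atTop (𝓝 y) := by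
    intro y hy
    have hy' : y ∈ closure (range (f ∘ c)) := by
      rw [range_comp]
      obtain ⟨x, rfl⟩ := hy
      exact image_closure_subset_closure_image hf
        (mem_image_of_mem f ((TopologicalSpace.denseRange_denseSeq C) x))
    simpa [SimpleFunc.nearestPt] using SimpleFunc.tendsto_nearestPt hy'
  let ν : ℕ → ProbabilityMeasure C := fun N => μ.map (hs N).aemeasurable
  let U : Ultrafilter ℕ := hyperfilter ℕ
  have hU : (U : Filter ℕ) ≤ atTop := by
    rw [← Nat.cofinite_eq_atTop]; exact hyperfilter_le_cofinite
  obtain ⟨ν', -, hν'⟩ := isCompact_univ.ultrafilter_le_nhds (U.map ν) (by simp)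
  have hν' : Tendsto ν U (𝓝 ν') := hν'
  refine ⟨ν', ?_⟩
  have h1 := ProbabilityMeasure.tendsto_map_of_tendsto_of_continuous ν ν' hν' hf
  have h2 : Tendsto (fun N => (ν N).map hf.measurable.aemeasurable) U (𝓝 μ) := by
    refine Tendsto.mono_left ?_ hU
    rw [ProbabilityMeasure.tendsto_iff_forall_integral_tendsto]
    intro g
    have key : ∀ N, ∫ y, g y ∂(((ν N).map hf.measurable.aemeasurable : ProbabilityMeasure F)
        : Measure F) = ∫ y, g (f (s N y)) ∂(μ : Measure F) := by
      intro N
      simp only [ν, ProbabilityMeasure.toMeasure_map]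
      rw [Measure.map_map hf.measurable (hs N), integral_map]
      · rfl
      · exact (hf.measurable.comp (hs N)).aemeasurable
      · exact g.continuous.measurable.aestronglyMeasurable
    simp only [key]
    refine tendsto_integral_of_dominated_convergence (fun _ => ‖g‖) ?_ (integrable_const _) ?_ ?_
    · intro N
      exact (g.continuous.measurable.comp (hf.measurable.comp (hs N))).aestronglyMeasurable
    · exact fun N => ae_of_all _ fun y => g.norm_coe_le_norm _
    · filter_upwards [hμ] with y hy
      exact (g.continuous.tendsto y).comp (hlim y hy)
  exact tendsto_nhds_unique h1 h2

theorem exists_measure_map_eq_of_compactSpace {C F : Type*} [TopologicalSpace C]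
    [CompactSpace C] [TopologicalSpace.MetrizableSpace C] [MeasurableSpace C] [BorelSpace C]
    [TopologicalSpace F] [TopologicalSpace.MetrizableSpace F] [MeasurableSpace F] [BorelSpace F]
    {f : C → F} (hf : Continuous f) (μ : Measure F) [IsFiniteMeasure μ]
    (hμ : ∀ᵐ y ∂μ, y ∈ range f) :
    ∃ ν : Measure C, ν.map f = μ := by
  by_cases h0 : μ = 0
  · exact ⟨0, by simp [h0]⟩
  have h0' : μ univ ≠ 0 := by simpa using h0
  have : NeZero μ := ⟨h0⟩
  have hp : IsProbabilityMeasure ((μ univ)⁻¹ • μ) := inferInstance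
  obtain ⟨ν, hν⟩ := exists_probabilityMeasure_map_eq_of_compactSpace hf ⟨_, hp⟩
    (Measure.ae_smul_measure hμ _)
  refine ⟨μ univ • (ν : Measure C), ?_⟩
  have := congrArg (fun m : ProbabilityMeasure F => (m : Measure F)) hν
  simp only [ProbabilityMeasure.toMeasure_map] at this
  rw [Measure.map_smul, this]
  change μ univ • (μ univ)⁻¹ • μ = μ
  rw [smul_smul, ENNReal.mul_inv_cancel h0' (measure_ne_top _ _), one_smul]

/-- Inner approximation of a finite measure by continuous images of compact sets. -/
theorem exists_isCompact_lt_measure_image {E F : Type*} [TopologicalSpace E] [PolishSpace E]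
    [TopologicalSpace F] [TopologicalSpace.MetrizableSpace F] [MeasurableSpace F] [BorelSpace F]
    {f : E → F} (hf : Continuous f) (μ : Measure F) [IsFiniteMeasure μ] {c : ℝ≥0∞}
    (hc : c < μ (range f)) : ∃ C : Set E, IsCompact C ∧ c ≤ μ (f '' C) := by
  let := TopologicalSpace.upgradeIsCompletelyMetrizable E
  have hne : Nonempty E := by
    by_contra h
    rw [not_nonempty_iff] at h
    simp [range_eq_empty] at hc
  let d := TopologicalSpace.denseSeq E
  let V : ℕ → ℕ → Set E := fun k N => ⋃ i ≤ N, Metric.closedBall (d i) (1 / ((k : ℝ) + 1))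
  have hVmono : ∀ k, Monotone (V k) := fun k N N' h =>
    biUnion_subset_biUnion_left fun i hi => le_trans hi h
  have hVcl : ∀ k N, IsClosed (V k N) := fun k N =>
    (finite_le_nat N).isClosed_biUnion fun i _ => Metric.isClosed_closedBall
  have hVun : ∀ k, ⋃ N, V k N = univ := by
    intro k
    refine eq_univ_of_forall fun x => ?_
    obtain ⟨i, hi⟩ := (TopologicalSpace.denseRange_denseSeq E).exists_dist_lt x
      (show (0 : ℝ) < 1 / ((k : ℝ) + 1) by positivity)
    exact mem_iUnion.2 ⟨i, mem_iUnion₂.2 ⟨i, le_rfl, hi.le⟩⟩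
  have step : ∀ (k : ℕ) (A : Set E), c < μ (f '' A) → ∃ N, c < μ (f '' (A ∩ V k N)) := by
    intro k A hA
    have h1 : f '' A = ⋃ N, f '' (A ∩ V k N) := by
      rw [← image_iUnion, ← inter_iUnion, hVun, inter_univ]
    have hm : Monotone fun N => f '' (A ∩ V k N) := fun N N' h =>
      image_mono (inter_subset_inter_right _ (hVmono k h))
    -- The images need not be measurable; continuity from below holds for arbitrary sets.
    rw [h1, hm.measure_iUnion] at hA
    exact lt_iSup_iff.1 hA
  choose N hN using step
  let A : ℕ → {A : Set E // c < μ (f '' A)} := fun k => Nat.rec ⟨univ, by rwa [image_univ]⟩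
    (fun k A => ⟨A.1 ∩ V k (N k A.1 A.2), hN k A.1 A.2⟩) k
  have hAs : ∀ k, (A (k + 1)).1 = (A k).1 ∩ V k (N k (A k).1 (A k).2) := fun k => rfl
  have hAcl : ∀ k, IsClosed (A k).1 := by
    intro k
    induction k with
    | zero => exact isClosed_univ
    | succ k ih => rw [hAs]; exact ih.inter (hVcl _ _)
  have hAanti : Antitone fun k => (A k).1 := antitone_nat_of_succ_le fun k => by
    rw [hAs]; exact inter_subset_left
  -- Each `A (k + 1)` is covered by finitely many balls of radius `1 / (k + 1)`, so such an
  -- ultrafilter contains one ball for each `k` and is Cauchy.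
  have ultra : ∀ U : Ultrafilter E, (∀ k, (A k).1 ∈ U) → ∃ a, (U : Filter E) ≤ 𝓝 a ∧
      a ∈ ⋂ k, (A k).1 := by
    intro U hU
    have hca : Cauchy (U : Filter E) := by
      rw [Metric.cauchy_iff]
      refine ⟨U.neBot, fun ε hε => ?_⟩
      obtain ⟨k, hk⟩ := exists_nat_one_div_lt (half_pos hε)
      have h1 : V k (N k (A k).1 (A k).2) ∈ U :=
        mem_of_superset (hU (k + 1)) (by rw [hAs]; exact inter_subset_right)
      obtain ⟨i, -, hi⟩ := (Ultrafilter.finite_biUnion_mem_iff (finite_le_nat _)).1 h1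
      refine ⟨_, hi, fun x hx y hy => ?_⟩
      have := dist_triangle_right x y (d i)
      rw [Metric.mem_closedBall] at hx hy
      linarith
    obtain ⟨a, ha⟩ := CompleteSpace.complete hca
    exact ⟨a, ha, mem_iInter.2 fun k => (hAcl k).mem_of_tendsto (b := (U : Filter E))
      (f := id) ha (hU k)⟩
  refine ⟨⋂ k, (A k).1, ?_, ?_⟩
  · rw [isCompact_iff_ultrafilter_le_nhds]
    intro U hU
    obtain ⟨a, ha, ha'⟩ := ultra U fun k =>
      mem_of_superset (le_principal_iff.1 hU) (iInter_subset _ k)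
    exact ⟨a, ha', ha⟩
  · have hsub : ⋂ k, closure (f '' (A k).1) ⊆ f '' ⋂ k, (A k).1 := by
      intro y hy
      have hne : (comap f (𝓝 y) ⊓ ⨅ k, 𝓟 (A k).1).NeBot := by
        rw [((nhds_basis_opens y).comap f).inf (hasBasis_iInf_principal
          hAanti.directed_ge) |>.neBot_iff]
        rintro ⟨W, k⟩ ⟨⟨hyW, hW⟩, -⟩
        obtain ⟨_, hz, x, hx, rfl⟩ := mem_closure_iff.1 (mem_iInter.1 hy k) W hW hyW
        exact ⟨x, hz, hx⟩
      let U := Ultrafilter.of (comap f (𝓝 y) ⊓ ⨅ k, 𝓟 (A k).1)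
      have hU := Ultrafilter.of_le (comap f (𝓝 y) ⊓ ⨅ k, 𝓟 (A k).1)
      obtain ⟨a, ha, ha'⟩ := ultra U fun k =>
        le_principal_iff.1 ((hU.trans inf_le_right).trans (iInf_le _ k))
      refine ⟨a, ha', ?_⟩
      have h1 : Tendsto f U (𝓝 y) := map_le_iff_le_comap.2 (hU.trans inf_le_left)
      exact tendsto_nhds_unique ((hf.tendsto a).mono_left ha) h1
    refine le_trans ?_ (measure_mono hsub)
    rw [Antitone.measure_iInter]
    · exact le_iInf fun k => ((A k).2.trans_le (measure_mono subset_closure)).le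
    · exact fun i j h => closure_mono (image_mono (hAanti h))
    · exact fun k => isClosed_closure.measurableSet.nullMeasurableSet
    · exact ⟨0, measure_ne_top _ _⟩

/-- Images of compact sets exhaust `μ` up to a null set. Cut into disjoint pieces, `μ` lifts piece
by piece through compact sets, and the lifts are summed. -/
theorem exists_measure_map_eq_of_continuous_surjective {E F : Type*} [TopologicalSpace E]
    [PolishSpace E] [MeasurableSpace E] [BorelSpace E]
    [TopologicalSpace F] [TopologicalSpace.MetrizableSpace F] [MeasurableSpace F] [BorelSpace F]
    {f : E → F} (hcont : Continuous f) (hsurj : Function.Surjective f)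
    (μ : Measure F) [IsFiniteMeasure μ] : ∃ ν : Measure E, ν.map f = μ := by
  have hf : Measurable f := hcont.measurable
  have hC : ∀ m : ℕ, ∃ C : Set E, IsCompact C ∧ μ univ - (m + 1 : ℝ≥0∞)⁻¹ ≤ μ (f '' C) := by
    intro m
    by_cases h0 : μ univ = 0
    · exact ⟨∅, isCompact_empty, by simp [h0]⟩
    · refine exists_isCompact_lt_measure_image hcont μ ?_
      rw [hsurj.range_eq]
      exact ENNReal.sub_lt_self (measure_ne_top _ _) h0 (by simp [ENNReal.add_eq_top])
  choose C hCc hCm using hC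
  have hfm : ∀ m, MeasurableSet (f '' C m) := fun m => ((hCc m).image hcont).measurableSet
  have hnull : μ (⋃ m, f '' C m)ᶜ = 0 := by
    have hb : ∀ m : ℕ, μ (⋃ m, f '' C m)ᶜ ≤ (m + 1 : ℝ≥0∞)⁻¹ := by
      intro m
      calc μ (⋃ m, f '' C m)ᶜ ≤ μ (f '' C m)ᶜ :=
            measure_mono (compl_subset_compl.2 (subset_iUnion (fun m => f '' C m) m))
        _ = μ univ - μ (f '' C m) := measure_compl (hfm m) (measure_ne_top _ _)
        _ ≤ _ := tsub_le_iff_tsub_le.1 (hCm m)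
    have ht : Tendsto (fun m : ℕ => (m + 1 : ℝ≥0∞)⁻¹) atTop (𝓝 0) := by
      have := (tendsto_add_atTop_iff_nat 1).2 ENNReal.tendsto_inv_nat_nhds_zero
      simpa using this
    exact le_antisymm (ge_of_tendsto' ht hb) bot_le
  let D : ℕ → Set F := disjointed fun m => f '' C m
  have hD : ∀ m, MeasurableSet (D m) := MeasurableSet.disjointed hfm
  have hlift : ∀ m, ∃ ν : Measure E, ν.map f = μ.restrict (D m) := by
    intro m
    have : CompactSpace (C m) := isCompact_iff_compactSpace.1 (hCc m)
    obtain ⟨ν, hν⟩ := exists_measure_map_eq_of_compactSpace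
      (f := fun x : C m => f x) (hcont.comp continuous_subtype_val) (μ.restrict (D m)) (by
        filter_upwards [ae_restrict_mem (hD m)] with y hy
        obtain ⟨x, hx, rfl⟩ := disjointed_subset _ m hy
        exact ⟨⟨x, hx⟩, rfl⟩)
    refine ⟨ν.map Subtype.val, ?_⟩
    rw [Measure.map_map hf measurable_subtype_coe]
    exact hν
  choose ν hν using hlift
  refine ⟨Measure.sum ν, ?_⟩
  rw [Measure.map_sum hf.aemeasurable]
  simp only [hν]
  rw [← Measure.restrict_iUnion (disjoint_disjointed _) hD, iUnion_disjointed]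
  exact Measure.restrict_eq_self_of_ae_mem (by rw [ae_iff]; exact hnull)

/-- Finite measures lift through measurable surjections from a standard Borel space. -/
theorem exists_measure_map_eq_of_surjective {E F : Type*} [MeasurableSpace E]
    [StandardBorelSpace E] [TopologicalSpace F] [TopologicalSpace.MetrizableSpace F]
    [SecondCountableTopology F] [MeasurableSpace F] [BorelSpace F]
    {f : E → F} (hf : Measurable f) (hsurj : Function.Surjective f)
    (μ : Measure F) [IsFiniteMeasure μ] : ∃ ν : Measure E, ν.map f = μ := by
  obtain ⟨t, hB, hP⟩ := StandardBorelSpace.polish (α := E)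
  -- A finer Polish topology makes `f` continuous without changing the Borel σ-algebra.
  obtain ⟨t', ht', hcont, hpol⟩ := hf.exists_continuous
  have hB' : @BorelSpace E t' _ := by
    refine @BorelSpace.mk _ t' _ ?_
    rw [borel_eq_borel_of_le hpol hP ht']
    exact hB.measurable_eq
  exact @exists_measure_map_eq_of_continuous_surjective E F t' hpol _ hB' _ _ _ _ f hcont hsurj μ _

/-! ### Minimax by Hahn–Banach and Riesz -/

/-- A minimax theorem for a convex set of continuous functions on a compact space. -/
theorem exists_probabilityMeasure_le_integral {X : Type*} [TopologicalSpace X] [CompactSpace X]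
    [T2Space X] [MeasurableSpace X] [BorelSpace X] {S : Set C(X, ℝ)}
    (hS : Convex ℝ S) (hSne : S.Nonempty) {c : ℝ} (hc : ∀ g ∈ S, ∃ x, c ≤ g x) :
    ∃ Q : ProbabilityMeasure X, ∀ g ∈ S, c ≤ ∫ x, g x ∂(Q : Measure X) := by
  let O : Set C(X, ℝ) := {h | ∀ x, h x < c}
  have hOo : IsOpen O := by
    have := ContinuousMap.isOpen_setOfPred_mapsTo (X := X) (Y := ℝ) isCompact_univ
      (isOpen_Iio (a := c))
    simpa [O, MapsTo] using this
  have hOc : Convex ℝ O := by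
    intro f hf g hg a b ha hb hab x
    have := (convex_Iio c) (hf x) (hg x) ha hb hab
    simpa using this
  obtain ⟨φ, u, hφO, hφS⟩ := geometric_hahn_banach_open hOc hOo hS (by
    rw [Set.disjoint_left]
    intro g hgO hgS
    obtain ⟨x, hx⟩ := hc g hgS
    exact absurd (hgO x) (not_lt.2 hx))
  -- `O` is stable under subtracting multiples `r • h` with `r ≥ 0`, and `φ` is bounded above by `u`
  -- on `O`.
  have hpos : ∀ h : C(X, ℝ), (∀ x, 0 ≤ h x) → 0 ≤ φ h := by
    intro h hh
    by_contra! hneg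
    let k : C(X, ℝ) := ContinuousMap.const X (c - 1)
    obtain ⟨r, hr⟩ := exists_nat_gt ((u - φ k) / (-φ h))
    have h1 : k - (r : ℝ) • h ∈ O := fun x => by
      have : 0 ≤ (r : ℝ) * h x := mul_nonneg r.cast_nonneg (hh x)
      simp [k]; linarith
    have h2 := hφO _ h1
    rw [map_sub, map_smul, smul_eq_mul] at h2
    rw [div_lt_iff₀ (by linarith)] at hr
    linarith
  obtain ⟨g₀, hg₀⟩ := hSne
  have hconst : ∀ t : ℝ, φ (ContinuousMap.const X t) = t * φ 1 := by
    intro t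
    rw [← smul_eq_mul, ← map_smul]
    congr 1
    ext x; simp
  -- If `φ 1 = 0`, then `φ` kills constants, so `0 < u ≤ φ g₀ ≤ φ ‖g₀‖ = 0`.
  have h1pos : 0 < φ 1 := by
    refine lt_of_le_of_ne (hpos 1 fun _ => zero_le_one) fun h0 => ?_
    have h1 : φ (ContinuousMap.const X (c - 1)) < u := hφO _ fun x => by simp
    have h2 := hφS g₀ hg₀
    have h3 : 0 ≤ φ (ContinuousMap.const X ‖g₀‖ - g₀) := hpos _ fun x => by
      have := (le_abs_self _).trans (g₀.norm_coe_le_norm x)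
      simpa using this
    rw [map_sub] at h3
    simp only [hconst, ← h0, mul_zero] at h1 h3
    linarith
  let Λ : CompactlySupportedContinuousMap X ℝ →ₚ[ℝ] ℝ :=
    PositiveLinearMap.mk₀
      { toFun := fun f => φ (f : C(X, ℝ))
        map_add' := fun f g => by rw [← map_add]; rfl
        map_smul' := fun r f => by rw [RingHom.id_apply, ← map_smul]; rfl }
      (fun f hf => hpos _ fun x => hf x)
  let m := RealRMK.rieszMeasure Λ
  have hm : ∀ h : C(X, ℝ), ∫ x, h x ∂m = φ h := fun h =>
    RealRMK.integral_rieszMeasure Λ ⟨h, HasCompactSupport.of_compactSpace _⟩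
  have hreal : m.real univ = φ 1 := by
    have := hm 1
    simpa using this
  have hfin : m univ ≠ ∞ := by
    intro h
    rw [Measure.real, h] at hreal
    simp at hreal
    linarith
  have hne0 : m univ ≠ 0 := by
    intro h
    rw [Measure.real, h] at hreal
    simp at hreal
    linarith
  have : IsFiniteMeasure m := ⟨lt_top_iff_ne_top.2 hfin⟩
  have : NeZero m := ⟨fun h => hne0 (by simp [h])⟩
  refine ⟨⟨(m univ)⁻¹ • m, inferInstance⟩, fun g hg => ?_⟩
  change c ≤ ∫ x, g x ∂((m univ)⁻¹ • m)
  rw [integral_smul_measure, hm, ENNReal.toReal_inv]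
  change c ≤ (m.real univ)⁻¹ • φ g
  rw [hreal, smul_eq_mul, inv_mul_eq_div, le_div_iff₀ h1pos]
  refine le_trans ?_ (hφS g hg)
  refine le_of_forall_pos_le_add fun ε hε => ?_
  have := hφO (ContinuousMap.const X (c - ε / φ 1)) fun x => by
    have := div_pos hε h1pos
    simpa using this
  rw [hconst, sub_mul, div_mul_cancel₀ _ h1pos.ne'] at this
  linarith

/-! ### Risks of randomized estimators -/

section Basic

variable {𝒳 T : Type*} [MeasurableSpace 𝒳] [MeasurableSpace T]
  {P : T → ProbabilityMeasure 𝒳} {n : ℕ} {M : T → T → ℝ}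

instance (θ : T) : IsProbabilityMeasure (sampleLaw P n θ) := by
  unfold sampleLaw; infer_instance

/-- A deterministic estimator, viewed as a randomized one. -/
noncomputable def DetEstimator.toRand (f : DetEstimator 𝒳 T n)
    (hf : ∀ θ, Integrable (fun x => M (f.1 x) θ) (sampleLaw P n θ)) : RandEstimator P n M where
  Ω := Unit
  mΩ := inferInstance
  law := Measure.dirac ()
  isProb := inferInstance
  est := fun _ => f
  measurable_est := f.2.comp measurable_snd
  integrable_loss := fun θ => (hf θ).comp_snd _

theorem risk_eq_integral_detRisk (δ : RandEstimator P n M) (θ : T) :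
    risk δ θ = ∫ ω, detRisk P M (δ.est ω) θ ∂δ.law :=
  integral_prod _ (δ.integrable_loss θ)

theorem integrable_detRisk (δ : RandEstimator P n M) (θ : T) :
    Integrable (fun ω => detRisk P M (δ.est ω) θ) δ.law :=
  (δ.integrable_loss θ).integral_prod_left

theorem risk_toRand (f : DetEstimator 𝒳 T n)
    (hf : ∀ θ, Integrable (fun x => M (f.1 x) θ) (sampleLaw P n θ)) (θ : T) :
    risk (f.toRand hf) θ = detRisk P M f θ := by
  rw [risk_eq_integral_detRisk]
  exact integral_dirac (fun _ : Unit => detRisk P M f θ) ()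

theorem intRisk_toRand (f : DetEstimator 𝒳 T n)
    (hf : ∀ θ, Integrable (fun x => M (f.1 x) θ) (sampleLaw P n θ)) (Q : ProbabilityMeasure T) :
    intRisk (f.toRand hf) Q = detIntRisk P M f Q := by
  simp only [intRisk, detIntRisk, risk_toRand]

theorem abs_risk_sub_le {D : T → T → ℝ}
    (hD : ∀ (f : DetEstimator 𝒳 T n) θ₁ θ₂, |detRisk P M f θ₁ - detRisk P M f θ₂| ≤ D θ₁ θ₂)
    (δ : RandEstimator P n M) (θ₁ θ₂ : T) : |risk δ θ₁ - risk δ θ₂| ≤ D θ₁ θ₂ := by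
  rw [risk_eq_integral_detRisk, risk_eq_integral_detRisk,
    ← integral_sub (integrable_detRisk δ θ₁) (integrable_detRisk δ θ₂), ← Real.norm_eq_abs]
  refine (norm_integral_le_of_norm_le_const (ae_of_all _ fun ω => ?_)).trans_eq
    (by rw [probReal_univ, mul_one])
  exact hD _ _ _

theorem abs_risk_le {C : ℝ} (hC : ∀ (f : DetEstimator 𝒳 T n) θ, |detRisk P M f θ| ≤ C)
    (δ : RandEstimator P n M) (θ : T) : |risk δ θ| ≤ C := by
  rw [risk_eq_integral_detRisk, ← Real.norm_eq_abs]
  refine (norm_integral_le_of_norm_le_const (ae_of_all _ fun ω => ?_)).trans_eq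
    (by rw [probReal_univ, mul_one])
  exact hC _ _

/-- A coin with weights `a` and `b` chooses which estimator to use; the disjoint union of the
sampling spaces carries the result. This gives convexity of the set of risk functions. -/
theorem exists_risk_eq_mix (δ₁ δ₂ : RandEstimator P n M) {a b : ℝ} (ha : 0 ≤ a) (hb : 0 ≤ b)
    (hab : a + b = 1) :
    ∃ δ : RandEstimator P n M, ∀ θ, risk δ θ = a * risk δ₁ θ + b * risk δ₂ θ := by
  let e : δ₁.Ω ⊕ δ₂.Ω → DetEstimator 𝒳 T n := Sum.elim δ₁.est δ₂.est
  let l : Measure (δ₁.Ω ⊕ δ₂.Ω) :=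
    ENNReal.ofReal a • δ₁.law.map Sum.inl + ENNReal.ofReal b • δ₂.law.map Sum.inr
  have p₁ : IsProbabilityMeasure (δ₁.law.map (Sum.inl (β := δ₂.Ω))) :=
    Measure.isProbabilityMeasure_map measurable_inl.aemeasurable
  have p₂ : IsProbabilityMeasure (δ₂.law.map (Sum.inr (α := δ₁.Ω))) :=
    Measure.isProbabilityMeasure_map measurable_inr.aemeasurable
  have hl : IsProbabilityMeasure l := ⟨by
    simp [l, ← ENNReal.ofReal_add ha hb, hab]⟩
  have hprod : ∀ θ, l.prod (sampleLaw P n θ) =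
      ENNReal.ofReal a • (δ₁.law.prod (sampleLaw P n θ)).map (Prod.map Sum.inl id)
      + ENNReal.ofReal b • (δ₂.law.prod (sampleLaw P n θ)).map (Prod.map Sum.inr id) := by
    intro θ
    rw [← Measure.map_prod_map _ _ measurable_inl measurable_id,
      ← Measure.map_prod_map _ _ measurable_inr measurable_id, Measure.map_id,
      Measure.add_prod, Measure.prod_smul_left, Measure.prod_smul_left]
  have m₁ : MeasurableEmbedding (Prod.map (Sum.inl (α := δ₁.Ω) (β := δ₂.Ω))
      (id : (Fin n → 𝒳) → _)) :=
    MeasurableEmbedding.prodMap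
      ⟨Sum.inl_injective, measurable_inl, fun _ hs => measurableSet_inl_image.2 hs⟩ .id
  have m₂ : MeasurableEmbedding (Prod.map (Sum.inr (α := δ₁.Ω) (β := δ₂.Ω))
      (id : (Fin n → 𝒳) → _)) :=
    MeasurableEmbedding.prodMap
      ⟨Sum.inr_injective, measurable_inr, fun _ hs => measurableSet_inr_image.2 hs⟩ .id
  have i₁ : ∀ θ, Integrable (fun p : (δ₁.Ω ⊕ δ₂.Ω) × (Fin n → 𝒳) => M ((e p.1).1 p.2) θ)
      (ENNReal.ofReal a • (δ₁.law.prod (sampleLaw P n θ)).map (Prod.map Sum.inl id)) := fun θ =>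
    Integrable.smul_measure ((m₁.integrable_map_iff
      (g := fun p : (δ₁.Ω ⊕ δ₂.Ω) × (Fin n → 𝒳) => M ((e p.1).1 p.2) θ)).2 (δ₁.integrable_loss θ))
        ENNReal.ofReal_ne_top
  have i₂ : ∀ θ, Integrable (fun p : (δ₁.Ω ⊕ δ₂.Ω) × (Fin n → 𝒳) => M ((e p.1).1 p.2) θ)
      (ENNReal.ofReal b • (δ₂.law.prod (sampleLaw P n θ)).map (Prod.map Sum.inr id)) := fun θ =>
    Integrable.smul_measure ((m₂.integrable_map_iff
      (g := fun p : (δ₁.Ω ⊕ δ₂.Ω) × (Fin n → 𝒳) => M ((e p.1).1 p.2) θ)).2 (δ₂.integrable_loss θ))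
        ENNReal.ofReal_ne_top
  refine ⟨⟨δ₁.Ω ⊕ δ₂.Ω, inferInstance, l, hl, e, ?_, fun θ => ?_⟩, fun θ => ?_⟩
  · have : Measurable (Sum.elim (fun p : δ₁.Ω × (Fin n → 𝒳) => (δ₁.est p.1).1 p.2)
        (fun p : δ₂.Ω × (Fin n → 𝒳) => (δ₂.est p.1).1 p.2)) :=
      Measurable.sumElim δ₁.measurable_est δ₂.measurable_est
    convert this.comp (MeasurableEquiv.sumProdDistrib δ₁.Ω δ₂.Ω (Fin n → 𝒳)).measurable using 1
    ext ⟨ω | ω, x⟩ <;> rfl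
  · rw [hprod]
    exact (i₁ θ).add_measure (i₂ θ)
  · simp only [risk]
    rw [hprod, integral_add_measure (i₁ θ) (i₂ θ), integral_smul_measure, integral_smul_measure,
      m₁.integral_map, m₂.integral_map, ENNReal.toReal_ofReal ha, ENNReal.toReal_ofReal hb]
    rfl

end Basic

/-! ### Equality of the values and Bayes risks -/

section Compact

variable {𝒳 T : Type*} [MeasurableSpace 𝒳] [MeasurableSpace T] [TopologicalSpace T]
  [CompactSpace T]
  {P : T → ProbabilityMeasure 𝒳} {n : ℕ} {M : T → T → ℝ}

theorem continuous_of_abs_sub_le {T : Type*} [TopologicalSpace T] {D : T → T → ℝ}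
    (hDc : Continuous fun p : T × T => D p.1 p.2)
    (hD0 : ∀ θ, D θ θ = 0) {g : T → ℝ} (hg : ∀ θ₁ θ₂, |g θ₁ - g θ₂| ≤ D θ₁ θ₂) :
    Continuous g := by
  rw [continuous_iff_continuousAt]
  intro θ
  have h1 : Tendsto (fun θ' => D θ' θ) (𝓝 θ) (𝓝 0) := by
    have := (hDc.comp (Continuous.prodMk_left θ)).tendsto θ
    simpa [hD0, Function.comp_def] using this
  rw [ContinuousAt, tendsto_iff_dist_tendsto_zero]
  exact squeeze_zero (fun _ => dist_nonneg) (fun θ' => by rw [Real.dist_eq]; exact hg _ _) h1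

theorem intRisk_le [BorelSpace T] {δ : RandEstimator P n M} (hδ : Continuous (risk δ)) {c : ℝ}
    (hc : ∀ θ, risk δ θ ≤ c) (Q : ProbabilityMeasure T) : intRisk δ Q ≤ c := by
  have := integral_mono (μ := (Q : Measure T)) (hδ.integrable_of_hasCompactSupport
    (HasCompactSupport.of_compactSpace _)) (integrable_const c) hc
  simpa [intRisk] using this

theorem exists_worstRisk_eq [Nonempty T] {δ : RandEstimator P n M} (hδ : Continuous (risk δ)) :
    ∃ θ, worstRisk δ = (risk δ θ : EReal) := by
  obtain ⟨θ, -, hθ⟩ := isCompact_univ.exists_isMaxOn univ_nonempty hδ.continuousOn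
  exact ⟨θ, le_antisymm (iSup_le fun θ' => EReal.coe_le_coe_iff.2 (hθ (mem_univ θ')))
    (le_iSup (fun θ' => (risk δ θ' : EReal)) θ)⟩

theorem iSup_intRisk_eq_worstRisk [BorelSpace T] [Nonempty T] [T2Space T] {δ : RandEstimator P n M}
    (hδ : Continuous (risk δ)) :
    ⨆ Q : ProbabilityMeasure T, (intRisk δ Q : EReal) = worstRisk δ := by
  refine le_antisymm (iSup_le fun Q => ?_) (iSup_le fun θ => ?_)
  · obtain ⟨θ, hθ⟩ := exists_worstRisk_eq hδ
    rw [hθ, EReal.coe_le_coe_iff]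
    refine intRisk_le hδ (fun θ' => ?_) Q
    rw [← EReal.coe_le_coe_iff, ← hθ]
    exact le_iSup (fun θ' => (risk δ θ' : EReal)) θ'
  · refine le_trans (le_of_eq ?_) (le_iSup (fun Q : ProbabilityMeasure T => (intRisk δ Q : EReal))
      ⟨Measure.dirac θ, inferInstance⟩)
    congr 1
    exact (integral_dirac' _ θ hδ.stronglyMeasurable).symm

theorem minmaxValue_eq_iInf_worstRisk [BorelSpace T] [Nonempty T] [T2Space T]
    (hr : ∀ δ : RandEstimator P n M, Continuous (risk δ)) :
    minmaxValue P n M = ⨅ δ : RandEstimator P n M, worstRisk δ :=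
  iInf_congr fun δ => iSup_intRisk_eq_worstRisk (hr δ)

/-- A prior whose Bayes risk is at least `c`, if no estimator has a worst-case risk below `c`. -/
theorem exists_prior_le_intRisk [BorelSpace T] [Nonempty T] [T2Space T]
    [Nonempty (RandEstimator P n M)]
    (hr : ∀ δ : RandEstimator P n M, Continuous (risk δ)) {c : ℝ}
    (hc : (c : EReal) ≤ minmaxValue P n M) :
    ∃ Q : ProbabilityMeasure T, ∀ δ : RandEstimator P n M, c ≤ intRisk δ Q := by
  let S : Set C(T, ℝ) := range fun δ : RandEstimator P n M => ⟨risk δ, hr δ⟩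
  have hS : Convex ℝ S := by
    rintro _ ⟨δ₁, rfl⟩ _ ⟨δ₂, rfl⟩ a b ha hb hab
    obtain ⟨δ, hδ⟩ := exists_risk_eq_mix δ₁ δ₂ ha hb hab
    exact ⟨δ, ContinuousMap.ext fun θ => by simp [hδ]⟩
  obtain ⟨Q, hQ⟩ := exists_probabilityMeasure_le_integral hS (range_nonempty _) (c := c) (by
    rintro _ ⟨δ, rfl⟩
    obtain ⟨θ, hθ⟩ := exists_worstRisk_eq (hr δ)
    refine ⟨θ, EReal.coe_le_coe_iff.1 ?_⟩
    change (c : EReal) ≤ (risk δ θ : EReal)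
    rw [← hθ]
    rw [minmaxValue_eq_iInf_worstRisk hr] at hc
    exact hc.trans (iInf_le _ δ))
  exact ⟨Q, fun δ => hQ _ ⟨δ, rfl⟩⟩

/-- Testing against real `c` above the max-min value also covers the value `-∞`, where no optimal
prior is sought. -/
theorem minmaxValue_eq_maxminValue [BorelSpace T] [Nonempty T] [T2Space T]
    [Nonempty (RandEstimator P n M)]
    (hr : ∀ δ : RandEstimator P n M, Continuous (risk δ)) :
    minmaxValue P n M = maxminValue P n M := by
  refine le_antisymm ?_ (iSup_iInf_le_iInf_iSup _)
  refine EReal.le_of_forall_lt_iff_le.1 fun c hc => ?_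
  by_contra! hlt
  obtain ⟨Q, hQ⟩ := exists_prior_le_intRisk hr hlt.le
  refine absurd hc (not_lt.2 (le_trans (le_iInf fun δ => EReal.coe_le_coe_iff.2 (hQ δ))
    (le_iSup (fun Q : ProbabilityMeasure T =>
      ⨅ δ : RandEstimator P n M, (intRisk δ Q : EReal)) Q)))

/-- Randomization does not improve the Bayes risk. -/
theorem iInf_detIntRisk_eq_iInf_intRisk [BorelSpace T] [TopologicalSpace.MetrizableSpace T]
    (hM : Measurable fun p : T × T => M p.1 p.2)
    (hint : ∀ (f : DetEstimator 𝒳 T n) (θ : T),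
      Integrable (fun x => M (f.1 x) θ) (sampleLaw P n θ))
    (hd : ∀ f : DetEstimator 𝒳 T n, Continuous (detRisk P M f))
    {C : ℝ} (hC : ∀ (f : DetEstimator 𝒳 T n) θ, |detRisk P M f θ| ≤ C)
    (Q : ProbabilityMeasure T) :
    ⨅ f : DetEstimator 𝒳 T n, (detIntRisk P M f Q : EReal)
      = ⨅ δ : RandEstimator P n M, (intRisk δ Q : EReal) := by
  refine le_antisymm (le_iInf fun δ => ?_) (le_iInf fun f => ?_)
  · have hmeas : Measurable (fun p : T × δ.Ω => detRisk P M (δ.est p.2) p.1) := by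
      let := TopologicalSpace.metrizableSpaceMetric T
      -- Carathéodory: continuous in `θ` and measurable in `ω` implies jointly measurable.
      refine (stronglyMeasurable_uncurry_of_continuous_of_stronglyMeasurable
        (u := fun θ ω => detRisk P M (δ.est ω) θ) (fun ω => hd _) (fun θ => ?_)).measurable
      have h1 : Measurable fun p : δ.Ω × (Fin n → 𝒳) => M ((δ.est p.1).1 p.2) θ :=
        hM.comp (δ.measurable_est.prodMk measurable_const)
      exact h1.stronglyMeasurable.integral_prod_right
    have hi : Integrable (fun p : T × δ.Ω => detRisk P M (δ.est p.2) p.1)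
        ((Q : Measure T).prod δ.law) :=
      Integrable.of_bound hmeas.aestronglyMeasurable C (ae_of_all _ fun p => hC _ _)
    have h1 : intRisk δ Q = ∫ ω, detIntRisk P M (δ.est ω) Q ∂δ.law := by
      simp only [intRisk, risk_eq_integral_detRisk, detIntRisk]
      exact integral_integral_swap hi
    obtain ⟨ω, hω⟩ := exists_le_integral (μ := δ.law)
      (f := fun ω => detIntRisk P M (δ.est ω) Q) hi.integral_prod_right
    rw [h1]
    exact (iInf_le _ (δ.est ω)).trans (EReal.coe_le_coe_iff.2 hω)
  · rw [← intRisk_toRand f (hint f)]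
    exact iInf_le _ _

end Compact

/-! ### Compactness for randomized estimators -/

/-- A sequence of probability measures is dominated by a probability measure with respect to which
suitable positive multiples have densities with values in the unit interval. -/
theorem exists_dominating {X : Type*} [MeasurableSpace X] (ρ : ℕ → Measure X)
    [∀ k, IsProbabilityMeasure (ρ k)] :
    ∃ (μ : Measure X) (τ : X → ℕ → I) (w : ℕ → ℝ), IsProbabilityMeasure μ ∧ Measurable τ ∧
      (∀ k, 0 < w k) ∧ ∀ k, ENNReal.ofReal (w k) • ρ k =
        μ.withDensity fun x => ENNReal.ofReal (τ x k) := by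
  -- The weights sum to one, so `μ` is a probability measure; `ν k ≤ μ` makes the densities at most
  -- one.
  let w : ℕ → ℝ := fun k => (2⁻¹ : ℝ) ^ (k + 1)
  have hw : ∀ k, 0 < w k := fun k => by positivity
  let ν : ℕ → Measure X := fun k => ENNReal.ofReal (w k) • ρ k
  have hνf : ∀ k, IsFiniteMeasure (ν k) := fun k => (ρ k).smul_finite ENNReal.ofReal_ne_top
  let μ : Measure X := Measure.sum ν
  have hμ : IsProbabilityMeasure μ := ⟨by
    have h2 : (2⁻¹ : ℝ≥0∞) = ENNReal.ofReal 2⁻¹ := by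
      rw [ENNReal.ofReal_inv_of_pos two_pos]; simp
    have : ∀ k, ν k univ = (2⁻¹ : ℝ≥0∞) ^ (k + 1) := fun k => by
      simp only [ν, w, Measure.smul_apply, measure_univ, smul_eq_mul, mul_one]
      rw [ENNReal.ofReal_pow (by positivity), ← h2]
    rw [Measure.sum_apply _ MeasurableSet.univ]
    simp_rw [this]
    rw [ENNReal.tsum_geometric_add_one, ENNReal.one_sub_inv_two, inv_inv]
    exact ENNReal.inv_mul_cancel (by simp) (by simp)⟩
  have hle : ∀ k, ν k ≤ μ := fun k => Measure.le_sum ν k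
  let τ : X → ℕ → I := fun x k => projIcc 0 1 zero_le_one ((ν k).rnDeriv μ x).toReal
  refine ⟨μ, τ, w, hμ, ?_, hw, fun k => ?_⟩
  · refine measurable_pi_lambda _ fun k => ?_
    exact continuous_projIcc.measurable.comp (Measure.measurable_rnDeriv _ _).ennreal_toReal
  · change ν k = _
    conv_lhs => rw [← Measure.withDensity_rnDeriv_eq (ν k) μ
      (Measure.absolutelyContinuous_of_le (hle k))]
    refine withDensity_congr_ae ?_
    filter_upwards [Measure.rnDeriv_le_one_of_le (hle k)] with x hx
    have hx' : ((ν k).rnDeriv μ x) ≤ 1 := hx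
    have h1 : ((ν k).rnDeriv μ x).toReal ∈ Icc (0 : ℝ) 1 :=
      ⟨ENNReal.toReal_nonneg, ENNReal.toReal_le_of_le_ofReal zero_le_one (by simpa using hx')⟩
    simp only [τ, projIcc_of_mem zero_le_one h1]
    rw [ENNReal.ofReal_toReal (ne_top_of_le_ne_top ENNReal.one_ne_top hx')]

/-- Change of measure in the data: the risks at all `θ k` become integrals against the same product
measure. -/
theorem integral_prod_eq_of_smul_eq_withDensity {Ω X : Type*} [MeasurableSpace Ω]
    [MeasurableSpace X] {l : Measure Ω} {ρ μ : Measure X} [SFinite l] [SFinite ρ] [SFinite μ]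
    {w : ℝ} (hw : 0 ≤ w) {t : X → I} (ht : Measurable t)
    (h : ENNReal.ofReal w • ρ = μ.withDensity fun x => ENNReal.ofReal (t x)) (g : Ω × X → ℝ) :
    w * ∫ p, g p ∂(l.prod ρ) = ∫ p, (t p.2 : ℝ) * g p ∂(l.prod μ) := by
  have hm : Measurable fun x => ENNReal.ofReal (t x : ℝ) :=
    (measurable_subtype_coe.comp ht).ennreal_ofReal
  have h1 : ENNReal.ofReal w • l.prod ρ =
      (l.prod μ).withDensity fun p => ENNReal.ofReal (t p.2) := by
    rw [← Measure.prod_smul_right, h, prod_withDensity_right hm]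
  have h2 := integral_smul_measure (μ := l.prod ρ) g (ENNReal.ofReal w)
  rw [ENNReal.toReal_ofReal hw, smul_eq_mul] at h2
  rw [← h2, h1, integral_withDensity_eq_integral_toReal_smul
    (f := fun p : Ω × X => ENNReal.ofReal (t p.2)) (hm.comp measurable_snd)
    (ae_of_all _ fun _ => ENNReal.ofReal_lt_top)]
  refine integral_congr_ae (ae_of_all _ fun p => ?_)
  simp [ENNReal.toReal_ofReal (t p.2).2.1]

/-- A joint law of a statistic and an element of a standard Borel space is realized by a
randomized function of the statistic. -/
theorem exists_randomized_map_eq {X Y T : Type*} [MeasurableSpace X] [MeasurableSpace Y]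
    [MeasurableSpace T] [StandardBorelSpace T] [Nonempty T] {μ : Measure X}
    [IsProbabilityMeasure μ] {τ : X → Y} (hτ : Measurable τ) (J : Measure (Y × T))
    [IsProbabilityMeasure J] (hJ : J.fst = μ.map τ) :
    ∃ g : Y → I → T, Measurable (Function.uncurry g) ∧
      ((volume : Measure I).prod μ).map (fun p => (τ p.2, g (τ p.2) p.1)) = J := by
  obtain ⟨g, hg, hgκ⟩ := ProbabilityTheory.Kernel.exists_measurable_map_eq_unitInterval J.condKernel
  refine ⟨g, hg, ?_⟩
  have hΦ : Measurable fun p : I × X => (τ p.2, g (τ p.2) p.1) :=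
    (hτ.comp measurable_snd).prodMk (hg.comp ((hτ.comp measurable_snd).prodMk measurable_fst))
  ext s hs
  rw [Measure.map_apply hΦ hs, Measure.prod_apply_symm (hΦ hs)]
  conv_rhs => rw [← J.disintegrate J.condKernel, Measure.compProd_apply hs, hJ,
    lintegral_map (ProbabilityTheory.Kernel.measurable_kernel_prodMk_left hs) hτ]
  refine lintegral_congr fun x => ?_
  have hgx : Measurable (g (τ x)) := hg.comp measurable_prodMk_left
  rw [← hgκ, Measure.map_apply hgx (measurable_prodMk_left hs)]
  rfl

section Limit

variable {𝒳 T : Type*} [MeasurableSpace 𝒳] [MeasurableSpace T]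
  {P : T → ProbabilityMeasure 𝒳} {n : ℕ} {M : T → T → ℝ}

theorem continuous_loss_left {T : Type*} (M : T → T → ℝ) (θ : T) :
    Continuous (X := LossSpace M) (Y := ℝ) (fun a => M a θ) := by
  refine LipschitzWith.continuous (K := 1) fun a b => ?_
  rw [ENNReal.coe_one, one_mul, edist_dist, Real.dist_eq]
  exact le_iSup (fun θ => ENNReal.ofReal |M a θ - M b θ|) θ

/-- If the losses form a compact space, then on a sequence of parameters the risk functions of
randomized estimators have limit points among them. -/
theorem exists_risk_le_of_sequence [StandardBorelSpace T] [Nonempty T]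
    (hM : Measurable fun p : T × T => M p.1 p.2) {C : ℝ} (hMC : ∀ a θ, |M a θ| ≤ C)
    [CompactSpace (LossSpace M)] (δ : ℕ → RandEstimator P n M) (θ : ℕ → T) {c : ℝ}
    (hδ : ∀ m k, risk (δ m) (θ k) ≤ c + 1 / ((m : ℝ) + 1)) :
    ∃ δ' : RandEstimator P n M, ∀ k, risk δ' (θ k) ≤ c := by
  obtain ⟨μ, τ, w, hμ, hτ, hw, hdens⟩ := exists_dominating fun k => sampleLaw P n (θ k)
  have hτk : ∀ k, Measurable fun x => τ x k := fun k => (measurable_pi_apply k).comp hτ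
  have hrisk : ∀ (δ : RandEstimator P n M) k, w k * risk δ (θ k) =
      ∫ p, (τ p.2 k : ℝ) * M ((δ.est p.1).1 p.2) (θ k) ∂(δ.law.prod μ) := fun δ k =>
    integral_prod_eq_of_smul_eq_withDensity (hw k).le (hτk k) (hdens k) _
  have hMm : ∀ θ, Measurable fun a => M a θ := fun θ =>
    hM.comp (measurable_id.prodMk measurable_const)
  let e₀ : T → ℕ → ℝ := fun a k => M a (θ k)
  have he₀ : Measurable e₀ := measurable_pi_lambda _ fun k => hMm _
  -- Compactness comes from `Δ_M`, for which each loss is 1-Lipschitz in the action.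
  have hK : CompactSpace (range e₀) := isCompact_iff_compactSpace.1
    (isCompact_range (X := LossSpace M) (continuous_pi fun k => continuous_loss_left M (θ k)))
  let e : T → range e₀ := rangeFactorization e₀
  have he : Measurable e := he₀.subtype_mk
  have hes : Function.Surjective e := rangeFactorization_surjective
  have hJm : ∀ m, Measurable fun p : (δ m).Ω × (Fin n → 𝒳) =>
      (τ p.2, e (((δ m).est p.1).1 p.2)) := fun m =>
    (hτ.comp measurable_snd).prodMk (he.comp (δ m).measurable_est)
  let J : ℕ → ProbabilityMeasure ((ℕ → I) × range e₀) := fun m =>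
    ⟨((δ m).law.prod μ).map _, Measure.isProbabilityMeasure_map (hJm m).aemeasurable⟩
  let U : Ultrafilter ℕ := hyperfilter ℕ
  have hU : (U : Filter ℕ) ≤ atTop := by
    rw [← Nat.cofinite_eq_atTop]; exact hyperfilter_le_cofinite
  obtain ⟨J', -, hJ'⟩ := isCompact_univ.ultrafilter_le_nhds (U.map J) (by simp)
  have hJ' : Tendsto J U (𝓝 J') := hJ'
  have hφ : ∀ k, Continuous fun q : (ℕ → I) × range e₀ => (q.1 k : ℝ) * q.2.1 k := fun k =>
    (continuous_subtype_val.comp ((continuous_apply k).comp continuous_fst)).mul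
      ((continuous_apply k).comp (continuous_subtype_val.comp continuous_snd))
  have hint : ∀ k, ∫ q, (q.1 k : ℝ) * q.2.1 k ∂(J' : Measure ((ℕ → I) × range e₀)) ≤ w k * c := by
    intro k
    have h1 := ((ProbabilityMeasure.continuous_integral_continuousMap
      (⟨_, hφ k⟩ : C((ℕ → I) × range e₀, ℝ))).tendsto J').comp hJ'
    have h2 : Tendsto (fun m : ℕ => w k * (c + 1 / ((m : ℝ) + 1))) U (𝓝 (w k * c)) := by
      refine Tendsto.mono_left ?_ hU
      simpa using (tendsto_one_div_add_atTop_nhds_zero_nat.const_add c).const_mul (w k)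
    refine le_of_tendsto_of_tendsto' h1 h2 fun m => ?_
    calc _ = w k * risk (δ m) (θ k) := by
          rw [hrisk]
          exact integral_map (hJm m).aemeasurable (hφ k).aestronglyMeasurable
      _ ≤ _ := mul_le_mul_of_nonneg_left (hδ m k) (hw k).le
  -- All `J m` have the same first marginal, which the limit therefore keeps.
  have hfst : (J' : Measure ((ℕ → I) × range e₀)).fst = μ.map τ := by
    have h1 := ProbabilityMeasure.tendsto_map_of_tendsto_of_continuous J J' hJ' continuous_fst
    have h2 : ∀ m, (J m).map continuous_fst.measurable.aemeasurable =
        ⟨μ.map τ, Measure.isProbabilityMeasure_map hτ.aemeasurable⟩ := fun m => by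
      refine Subtype.ext ?_
      change (((δ m).law.prod μ).map _).map Prod.fst = μ.map τ
      rw [Measure.map_map measurable_fst (hJm m)]
      change ((δ m).law.prod μ).map (τ ∘ Prod.snd) = _
      rw [← Measure.map_map hτ measurable_snd, Measure.map_snd_prod]
      simp
    simp only [h2] at h1
    have h3 := tendsto_nhds_unique tendsto_const_nhds h1
    exact (congrArg (fun m : ProbabilityMeasure (ℕ → I) => (m : Measure (ℕ → I))) h3).symm
  have hpm : Measurable (Prod.map id e : (ℕ → I) × T → _) := measurable_id.prodMap he
  -- `e` is only known to be measurable for the usual topology of the actions, so the limit law is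
  -- lifted by the Borel version of the lifting theorem.
  obtain ⟨J'', hJ''⟩ := exists_measure_map_eq_of_surjective hpm
    (Function.surjective_id.prodMap hes) (J' : Measure ((ℕ → I) × range e₀))
  have hJp : IsProbabilityMeasure J'' := ⟨by
    have : J''.map (Prod.map id e) univ = 1 := by rw [hJ'']; exact measure_univ
    rwa [Measure.map_apply hpm MeasurableSet.univ, preimage_univ] at this⟩
  obtain ⟨g, hg, hgJ⟩ := exists_randomized_map_eq hτ J'' (by
    rw [← hfst, ← hJ'', Measure.fst, Measure.fst, Measure.map_map measurable_fst hpm]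
    rfl)
  have hgm : Measurable fun p : I × (Fin n → 𝒳) => g (τ p.2) p.1 :=
    hg.comp ((hτ.comp measurable_snd).prodMk measurable_fst)
  let δ' : RandEstimator P n M :=
    { Ω := I
      mΩ := inferInstance
      law := volume
      isProb := inferInstance
      est := fun ω => ⟨fun x => g (τ x) ω, hgm.comp measurable_prodMk_left⟩
      measurable_est := hgm
      integrable_loss := fun θ => Integrable.of_bound
        ((hMm θ).comp hgm).aestronglyMeasurable C (ae_of_all _ fun p => hMC _ _) }
  refine ⟨δ', fun k => ?_⟩
  have h1 : w k * risk δ' (θ k) ≤ w k * c := by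
    refine le_trans (le_of_eq ?_) (hint k)
    rw [hrisk, ← hJ'', integral_map hpm.aemeasurable (hφ k).aestronglyMeasurable, ← hgJ,
      integral_map]
    · rfl
    · exact ((hτ.comp measurable_snd).prodMk hgm).aemeasurable
    · exact ((hφ k).measurable.comp hpm).aestronglyMeasurable
  exact le_of_mul_le_mul_left h1 (hw k)

end Limit

end StatGame

/-! ### The theorem -/

open StatGame in
theorem corollary2 {𝒳 : Type*} [MeasurableSpace 𝒳] {d n : ℕ}
    (Θ : Set (Fin d → ℝ)) (hΘ : IsCompact Θ) (hΘne : Θ.Nonempty)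
    (P : Θ → ProbabilityMeasure 𝒳)
    (M : Θ → Θ → ℝ) (hM : Measurable fun p : Θ × Θ => M p.1 p.2)
    (hint : ∀ (f : StatGame.DetEstimator 𝒳 Θ n) (θ : Θ),
      Integrable (fun x => M (f.1 x) θ) (StatGame.sampleLaw P n θ))
    (L : ℝ)
    (hLip : ∀ (f : StatGame.DetEstimator 𝒳 Θ n) (θ₁ θ₂ : Θ),
      |StatGame.detRisk P M f θ₁ - StatGame.detRisk P M f θ₂|
        ≤ L * ∑ i, |θ₁.1 i - θ₂.1 i|) :
    StatGame.minmaxValue P n M = StatGame.maxminValue P n M ∧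
    ((∃ C : ℝ, ∀ (f : StatGame.DetEstimator 𝒳 Θ n) (θ : Θ), |StatGame.detRisk P M f θ| ≤ C) →
      CompactSpace (StatGame.LossSpace M) →
      (∃ δ : StatGame.RandEstimator P n M, StatGame.IsMinimax δ ∧
        StatGame.worstRisk δ = StatGame.minmaxValue P n M) ∧
      (∃ Q : ProbabilityMeasure Θ, StatGame.IsLeastFavorable P n M Q ∧
        ⨅ f : StatGame.DetEstimator 𝒳 Θ n, (StatGame.detIntRisk P M f Q : EReal)
          = StatGame.minmaxValue P n M)) := by
  have hne : Nonempty Θ := hΘne.to_subtype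
  have hcs : CompactSpace Θ := isCompact_iff_compactSpace.1 hΘ
  have hpol : PolishSpace Θ := hΘ.isClosed.polishSpace
  have hDc : Continuous fun p : Θ × Θ => L * ∑ i, |p.1.1 i - p.2.1 i| :=
    continuous_const.mul (continuous_finsetSum _ fun i _ =>
      (((continuous_apply i).comp (continuous_subtype_val.comp continuous_fst)).sub
        ((continuous_apply i).comp (continuous_subtype_val.comp continuous_snd))).abs)
  have hD0 : ∀ θ : Θ, L * ∑ i, |θ.1 i - θ.1 i| = 0 := fun θ => by simp
  have hd : ∀ f : DetEstimator 𝒳 Θ n, Continuous (detRisk P M f) := fun f =>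
    continuous_of_abs_sub_le hDc hD0 (hLip f)
  have hr : ∀ δ : RandEstimator P n M, Continuous (risk δ) := fun δ =>
    continuous_of_abs_sub_le hDc hD0 (abs_risk_sub_le hLip δ)
  let const : Θ → DetEstimator 𝒳 Θ n := fun a => ⟨fun _ => a, measurable_const⟩
  have hrne : Nonempty (RandEstimator P n M) := ⟨(const hne.some).toRand (hint _)⟩
  have heq := minmaxValue_eq_maxminValue hr
  refine ⟨heq, ?_⟩
  rintro ⟨C, hC⟩ hcomp
  -- The risk of the constant estimator `a` is `M a θ`, so bounded risk bounds the loss.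
  have hMC : ∀ a θ, |M a θ| ≤ C := fun a θ => by
    simpa [detRisk, const] using hC (const a) θ
  have hworst := minmaxValue_eq_iInf_worstRisk hr
  obtain ⟨c, hc⟩ : ∃ c : ℝ, minmaxValue P n M = c := by
    have h1 : ((-C : ℝ) : EReal) ≤ minmaxValue P n M := by
      rw [hworst]
      refine le_iInf fun δ => le_trans ?_ (le_iSup (fun θ => (risk δ θ : EReal)) hne.some)
      exact EReal.coe_le_coe_iff.2 (abs_le.1 (abs_risk_le hC δ _)).1
    have h2 : minmaxValue P n M ≤ (C : ℝ) := by
      rw [hworst]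
      refine (iInf_le _ hrne.some).trans (iSup_le fun θ => ?_)
      exact EReal.coe_le_coe_iff.2 (abs_le.1 (abs_risk_le hC _ _)).2
    refine ⟨(minmaxValue P n M).toReal, (EReal.coe_toReal ?_ ?_).symm⟩
    · exact ne_top_of_le_ne_top (EReal.coe_ne_top _) h2
    · exact ne_bot_of_le_ne_bot (EReal.coe_ne_bot _) h1
  constructor
  · have hseq : ∀ m : ℕ, ∃ δ : RandEstimator P n M, ∀ θ, risk δ θ ≤ c + 1 / ((m : ℝ) + 1) := by
      intro m
      have h1 : ⨅ δ : RandEstimator P n M, worstRisk δ < ((c + 1 / ((m : ℝ) + 1) : ℝ) : EReal) := by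
        rw [← hworst, hc, EReal.coe_lt_coe_iff]
        have : 0 < 1 / ((m : ℝ) + 1) := by positivity
        linarith
      obtain ⟨δ, hδ⟩ := iInf_lt_iff.1 h1
      exact ⟨δ, fun θ => EReal.coe_le_coe_iff.1
        ((le_iSup (fun θ => (risk δ θ : EReal)) θ).trans hδ.le)⟩
    choose δ hδ using hseq
    obtain ⟨δ', hδ'⟩ := exists_risk_le_of_sequence hM hMC δ (TopologicalSpace.denseSeq Θ)
      fun m k => hδ m _
    have hle : ∀ θ, risk δ' θ ≤ c := fun θ =>
      (TopologicalSpace.denseRange_denseSeq Θ).induction_on θ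
        (isClosed_le (hr δ') continuous_const) hδ'
    have h1 : worstRisk δ' = minmaxValue P n M := by
      refine le_antisymm ?_ (hworst.trans_le (iInf_le _ δ'))
      rw [hc]
      exact iSup_le fun θ => EReal.coe_le_coe_iff.2 (hle θ)
    exact ⟨δ', h1.trans hworst, h1⟩
  · obtain ⟨Q, hQ⟩ := exists_prior_le_intRisk hr hc.ge
    have h1 : ⨅ δ : RandEstimator P n M, (intRisk δ Q : EReal) = maxminValue P n M := by
      refine le_antisymm (le_iSup (fun Q : ProbabilityMeasure Θ =>
        ⨅ δ : RandEstimator P n M, (intRisk δ Q : EReal)) Q) ?_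
      rw [← heq, hc]
      exact le_iInf fun δ => EReal.coe_le_coe_iff.2 (hQ δ)
    exact ⟨Q, h1, (iInf_detIntRisk_eq_iInf_intRisk hM hint hd hC Q).trans (h1.trans heq.symm)⟩
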